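/- Let $F(x)=\sum_{n\ge 0}a_nx^n$ be the generating function of the Motzkin numbers $a_n=\sum_{i\ge 0}\frac{1}{i+1}\binom{n}{2i}\binom{2i}{i}$. Write $F(x)^3=\sum_{n\ge 0}a_{3,n}x^n$, put $a_{3,n}=0$ for $n<0$, and for $n\ge 0$ let $$D_{3,-3}(n)=\det\bigl(a_{3,i+j-3}\bigr)_{0\le i,j\le n-1},$$ where $D_{3,-3}(0)=1$ (the empty determinant). Then $$D_{3,-3}(0)=1,\qquad D_{3,-3}(1)=D_{3,-3}(2)=D_{3,-3}(3)=0,$$ and for every integer $n\ge 4$, $$D_{3,-3}(n)=\begin{cases}k & \text{if } n=3k+1,\\ 0 & \text{if } n=3k+2,\\ -k & \text{if } n=3k+3,\end{cases}$$ where $k$ is the non-negative integer determined by $n$. -/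

import Mathlib

open scoped PowerSeries

noncomputable section

/-- The Motzkin number `∑_{i ≥ 0} 1/(i+1) * C(n, 2i) * C(2i, i)`; the terms with `2 * i > n` are zero,
so that the sum may be cut off at `i = n`. -/
def motzkinNumber (n : ℕ) : ℝ :=
  ∑ i ∈ Finset.range (n + 1), (1 / ((i : ℝ) + 1)) * (n.choose (2 * i) : ℝ) * ((2 * i).choose i : ℝ)

/-- The generating function of the Motzkin numbers. -/
def motzkinSeries : ℝ⟦X⟧ := PowerSeries.mk motzkinNumber

/-- The coefficient of `x ^ n` in the power series `F`, for an arbitrary integer `n`: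
it is zero when `n` is negative. -/
def intCoeff (F : ℝ⟦X⟧) (n : ℤ) : ℝ :=
  if n < 0 then 0 else PowerSeries.coeff n.toNat F

/-- The shifted Hankel determinant `D_{K,M}(N) = det (a_{K,i+j+M})_{0 ≤ i,j ≤ N-1}` of the convolution
power `F ^ K = ∑ a_{K,n} x ^ n`; for `N = 0` it is the empty determinant `1`. -/
def shiftedHankelDet (F : ℝ⟦X⟧) (K : ℕ) (M : ℤ) (N : ℕ) : ℝ :=
  (Matrix.of fun i j : Fin N => intCoeff (F ^ K) ((i : ℤ) + (j : ℤ) + M)).det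

end

/-!
Let `F` be the Motzkin series. From `F = 1 + x F + x² F²` one gets `x⁴ F³ = F - 1 - 2 x F + x`, so
that the entries of the Hankel matrix are `h_n = a_{n+1} - 2 a_n + [n = 0]`
(`intCoeff_motzkinSeries_cube`). In terms of the functional `L(tⁿ) = a_n` this says that `h_n` is
the `n`-th moment of `f ↦ L((t - 2) f) + f(0)`.

In the basis of the orthonormal monic polynomials `p_a` of `L`, whose Jacobi matrix has `1` on all
three diagonals, the Gram matrix of this functional is `B + v vᵀ`. Here `B` is the Jacobi matrix
minus `2` and `v_a = p_a(0)` is the sequence `1, -1, 0, 1, -1, 0, …`. The change of basis is the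
unitriangular Motzkin triangle (`hankel_eq_motzkinTriangle_mul`), so the determinants agree.

The determinant of the `n × n` matrix `B` obeys the recurrence of `v`, hence equals `v_n`
(`det_shiftedJacobi`). The vector `y` with `y_a = -v_a` for `n + a` odd and `y_a = 0` for `n + a`
even solves `B y = v`. Hence the determinant is `v_n (1 - ∑ v_a²)`, the sum over the `a < n` with
`n + a` odd (`shiftedHankelDet_eq`). By the periodicity of `v`, the sum is `k` for `n = 3 k` and
`k + 1` for `n = 3 k + 1`, while the factor `v_n` vanishes for `n = 3 k + 2`.
-/

/-! ### The quadratic equation of the Motzkin series -/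

open PowerSeries in
theorem coeff_X_pow_mul_mk_one_pow (d n : ℕ) :
    coeff n ((X : ℝ⟦X⟧) ^ d * (mk 1 : ℝ⟦X⟧) ^ (d + 1)) = (n.choose d : ℝ) := by
  rw [mk_one_pow_eq_mk_choose_add, coeff_X_pow_mul', coeff_mk]
  split_ifs with h
  · rw [Nat.add_sub_cancel' h]
  · rw [Nat.choose_eq_zero_of_lt (not_le.mp h), Nat.cast_zero]

theorem motzkinNumber_eq_sum_catalan (n : ℕ) :
    motzkinNumber n = ∑ i ∈ Finset.range (n + 1), (catalan i : ℝ) * (n.choose (2 * i) : ℝ) := by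
  refine Finset.sum_congr rfl fun i _ => ?_
  have h : ((i : ℝ) + 1) * (catalan i : ℝ) = ((2 * i).choose i : ℝ) := by
    exact_mod_cast succ_mul_catalan_eq_centralBinom i
  rw [← h]
  field_simp

open PowerSeries in
/-- The substitution `y = x² / (1 - x)²` into the Catalan series; the factor `1 - x` turns
`binom(n, 2 i)` into the coefficient `binom(n, 2 i) - binom(n - 1, 2 i)` of `y ^ i`. -/
theorem one_sub_X_mul_motzkinSeries :
    (1 - X) * motzkinSeries =
      (catalanSeries.map (Nat.castRingHom ℝ)).subst ((X : ℝ⟦X⟧) ^ 2 * (mk 1 : ℝ⟦X⟧) ^ 2) := by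
  have hy : HasSubst ((X : ℝ⟦X⟧) ^ 2 * (mk 1 : ℝ⟦X⟧) ^ 2) :=
    HasSubst.of_constantCoeff_zero' (by simp)
  have key (d n : ℕ) : coeff n (((X : ℝ⟦X⟧) ^ 2 * (mk 1 : ℝ⟦X⟧) ^ 2) ^ d) =
      coeff n ((1 - X) * ((X : ℝ⟦X⟧) ^ (2 * d) * (mk 1 : ℝ⟦X⟧) ^ (2 * d + 1))) := by
    congr 1
    linear_combination (-(X : ℝ⟦X⟧) ^ (2 * d) * (mk 1 : ℝ⟦X⟧) ^ (2 * d)) *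
      mk_one_mul_one_sub_eq_one ℝ
  ext n
  rw [coeff_subst' hy, finsum_eq_sum_of_support_subset (s := Finset.range (n + 1))]
  · simp only [key, sub_mul, one_mul, map_sub, smul_eq_mul, coeff_map, catalanSeries_coeff,
      coeff_X_pow_mul_mk_one_pow, mul_sub, Finset.sum_sub_distrib]
    congr 1
    · simp [motzkinSeries, motzkinNumber_eq_sum_catalan]
    · cases n with
      | zero => simp
      | succ n =>
        simp only [coeff_succ_X_mul, coeff_X_pow_mul_mk_one_pow]
        rw [Finset.sum_range_succ, Nat.choose_eq_zero_of_lt (by omega : n < 2 * (n + 1))]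
        simp [motzkinSeries, motzkinNumber_eq_sum_catalan]
  · intro d hd
    rw [Function.mem_support] at hd
    simp only [Finset.coe_range, Set.mem_Iio]
    by_contra hlt
    apply hd
    rw [mul_pow, ← pow_mul, coeff_X_pow_mul', if_neg (by omega), smul_zero]

open PowerSeries in
/-- The equation `C = 1 + y C²` of the Catalan series at `y = x² / (1 - x)²`, where
`C = (1 - x) F`. -/
theorem motzkinSeries_eq :
    motzkinSeries = 1 + X * motzkinSeries + X ^ 2 * motzkinSeries ^ 2 := by
  have hy : HasSubst ((X : ℝ⟦X⟧) ^ 2 * (mk 1 : ℝ⟦X⟧) ^ 2) :=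
    HasSubst.of_constantCoeff_zero' (by simp)
  have hC := congrArg (PowerSeries.map (Nat.castRingHom ℝ)) catalanSeries_sq_mul_X_add_one
  have hS := congrArg (substAlgHom (R := ℝ) hy) hC
  simp only [map_add, map_mul, map_pow, map_one, map_X, substAlgHom_X] at hS
  rw [coe_substAlgHom, ← one_sub_X_mul_motzkinSeries] at hS
  have h1 := mk_one_mul_one_sub_eq_one ℝ
  have h2 : (mk 1 : ℝ⟦X⟧) ^ 2 * (1 - X) ^ 2 = 1 := by rw [← mul_pow, h1, one_pow]
  linear_combination -hS + motzkinSeries ^ 2 * X ^ 2 * h2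

open PowerSeries in
/-- The generating function of the entries `a_{3,n-3}`, up to a factor `x`, is an affine function of
`F`: the quadratic equation of `F` reduces its cube to degree one. -/
theorem X_pow_four_mul_motzkinSeries_cube :
    X ^ 4 * motzkinSeries ^ 3 = motzkinSeries - 1 - 2 * (X * motzkinSeries) + X := by
  linear_combination (-X ^ 2 * motzkinSeries - (1 - X)) * motzkinSeries_eq

/-! ### The Motzkin triangle and the Jacobi operator -/

noncomputable section

/-- The Motzkin triangle: the coefficient of `x ^ i` in `x ^ a * F ^ (a + 1)`, which is the number
of Motzkin paths of length `i` from height `0` to height `a`. -/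
def motzkinTriangle (i a : ℕ) : ℝ :=
  PowerSeries.coeff i (PowerSeries.X ^ a * motzkinSeries ^ (a + 1))

/-- The Jacobi operator of the Motzkin numbers on sequences, with all three diagonals equal to `1`.
Row `i + 1` of the Motzkin triangle is its value at row `i`. -/
def jacobiOp (f : ℕ → ℝ) : ℕ → ℝ
  | 0 => f 0 + f 1
  | a + 1 => f a + f (a + 1) + f (a + 2)

/-- Green's identity: the Jacobi operator is symmetric up to a boundary term. -/
theorem sum_jacobiOp_mul_sub (f g : ℕ → ℝ) (N : ℕ) :
    ∑ a ∈ Finset.range (N + 1), (jacobiOp f a * g a - f a * jacobiOp g a) =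
      f (N + 1) * g N - f N * g (N + 1) := by
  induction N with
  | zero => simp [jacobiOp]; ring
  | succ N ih => rw [Finset.sum_range_succ, ih]; simp only [jacobiOp]; ring

theorem sum_jacobiOp_mul {f : ℕ → ℝ} (g : ℕ → ℝ) {N : ℕ} (h0 : f N = 0) (h1 : f (N + 1) = 0) :
    ∑ a ∈ Finset.range (N + 1), jacobiOp f a * g a =
      ∑ a ∈ Finset.range (N + 1), f a * jacobiOp g a := by
  rw [← sub_eq_zero, ← Finset.sum_sub_distrib, sum_jacobiOp_mul_sub, h0, h1]
  ring

theorem motzkinTriangle_of_lt {i a : ℕ} (h : i < a) : motzkinTriangle i a = 0 := by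
  rw [motzkinTriangle, PowerSeries.coeff_X_pow_mul', if_neg (by omega)]

theorem constantCoeff_motzkinSeries : PowerSeries.constantCoeff motzkinSeries = 1 := by
  simp [motzkinSeries, motzkinNumber]

theorem motzkinTriangle_self (i : ℕ) : motzkinTriangle i i = 1 := by
  simp [motzkinTriangle, PowerSeries.coeff_X_pow_mul', constantCoeff_motzkinSeries]

theorem motzkinTriangle_succ (i : ℕ) :
    motzkinTriangle (i + 1) = jacobiOp (motzkinTriangle i) := by
  funext a
  cases a with
  | zero =>
    have h : (PowerSeries.X : ℝ⟦X⟧) ^ 0 * motzkinSeries ^ (0 + 1) =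
        1 + PowerSeries.X * (PowerSeries.X ^ 0 * motzkinSeries ^ (0 + 1) +
          PowerSeries.X ^ 1 * motzkinSeries ^ (1 + 1)) := by
      linear_combination motzkinSeries_eq
    simp only [motzkinTriangle, jacobiOp]
    conv_lhs => rw [h]
    simp [PowerSeries.coeff_succ_X_mul, PowerSeries.coeff_one]
  | succ a =>
    have h : (PowerSeries.X : ℝ⟦X⟧) ^ (a + 1) * motzkinSeries ^ (a + 1 + 1) =
        PowerSeries.X * (PowerSeries.X ^ a * motzkinSeries ^ (a + 1) +
          PowerSeries.X ^ (a + 1) * motzkinSeries ^ (a + 1 + 1) +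
          PowerSeries.X ^ (a + 2) * motzkinSeries ^ (a + 2 + 1)) := by
      linear_combination (PowerSeries.X ^ (a + 1) * motzkinSeries ^ (a + 1)) * motzkinSeries_eq
    simp only [motzkinTriangle, jacobiOp]
    conv_lhs => rw [h]
    simp only [PowerSeries.coeff_succ_X_mul, map_add]

theorem motzkinTriangle_zero_left (a : ℕ) : motzkinTriangle 0 a = if a = 0 then 1 else 0 := by
  split_ifs with h
  · rw [h, motzkinTriangle_self]
  · exact motzkinTriangle_of_lt (Nat.pos_of_ne_zero h)

theorem motzkinTriangle_zero_right (i : ℕ) : motzkinTriangle i 0 = motzkinNumber i := by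
  simp [motzkinTriangle, motzkinSeries]

/-- The Cholesky factorization of the Hankel matrix of the Motzkin numbers. -/
theorem sum_motzkinTriangle_mul {i N : ℕ} (h : i < N) (j : ℕ) :
    ∑ a ∈ Finset.range N, motzkinTriangle i a * motzkinTriangle j a = motzkinNumber (i + j) := by
  induction i generalizing j with
  | zero =>
    simp [motzkinTriangle_zero_left, motzkinTriangle_zero_right, h.ne']
  | succ i ih =>
    obtain ⟨N, rfl⟩ := Nat.exists_eq_succ_of_ne_zero (Nat.ne_zero_of_lt h)
    rw [motzkinTriangle_succ, sum_jacobiOp_mul _ (motzkinTriangle_of_lt (by omega))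
      (motzkinTriangle_of_lt (by omega)), ← motzkinTriangle_succ, ih (by omega)]
    congr 1
    omega

/-- The values at `0` of the monic orthogonal polynomials `p_n` of the Motzkin numbers, which
satisfy `t p_n = p_{n+1} + p_n + p_{n-1}`. The sequence is `1, -1, 0`, repeated. -/
def orthoAtZero : ℕ → ℝ
  | 0 => 1
  | 1 => -1
  | n + 2 => -orthoAtZero (n + 1) - orthoAtZero n

theorem jacobiOp_orthoAtZero : jacobiOp orthoAtZero = 0 := by
  funext a
  cases a with
  | zero => simp [jacobiOp, orthoAtZero]
  | succ a => simp only [jacobiOp, orthoAtZero, Pi.zero_apply]; ring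

/-- The expansion `t ^ i = ∑ a, motzkinTriangle i a * p_a`, evaluated at `t = 0`. -/
theorem sum_motzkinTriangle_mul_orthoAtZero {i N : ℕ} (h : i < N) :
    ∑ a ∈ Finset.range N, motzkinTriangle i a * orthoAtZero a = if i = 0 then 1 else 0 := by
  cases i with
  | zero => simp [motzkinTriangle_zero_left, orthoAtZero, h.ne']
  | succ i =>
    obtain ⟨N, rfl⟩ := Nat.exists_eq_succ_of_ne_zero (Nat.ne_zero_of_lt h)
    rw [motzkinTriangle_succ, sum_jacobiOp_mul _ (motzkinTriangle_of_lt (by omega))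
      (motzkinTriangle_of_lt (by omega)), jacobiOp_orthoAtZero]
    simp

/-! ### The Hankel matrix as a perturbed tridiagonal matrix -/

open PowerSeries in
/-- The entries of the Hankel matrix are `⟨e₀, (J - 2) Jⁿ e₀⟩` for the Jacobi operator `J`, but for
a correction at `n = 0`. -/
theorem intCoeff_motzkinSeries_cube (n : ℕ) :
    intCoeff (motzkinSeries ^ 3) ((n : ℤ) - 3) =
      motzkinNumber (n + 1) - 2 * motzkinNumber n + if n = 0 then 1 else 0 := by
  have h := congrArg (coeff (n + 1)) X_pow_four_mul_motzkinSeries_cube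
  have h2 : (2 : ℝ⟦X⟧) * (X * motzkinSeries) = X * ((2 : ℝ) • motzkinSeries) := by
    rw [PowerSeries.smul_eq_C_mul, map_ofNat]; ring
  rw [h2] at h
  simp only [map_add, map_sub, coeff_succ_X_mul, coeff_X_pow_mul', coeff_one, coeff_X, map_smul,
    smul_eq_mul, Nat.add_eq_zero_iff, one_ne_zero, and_false, if_false, sub_zero,
    Nat.add_eq_right] at h
  simp only [motzkinSeries, coeff_mk] at h
  rw [← h, intCoeff]
  by_cases h3 : 3 ≤ n
  · rw [if_neg (by omega), if_pos (by omega), show ((n : ℤ) - 3).toNat = n + 1 - 4 by omega]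
    rfl
  · rw [if_pos (by omega), if_neg (by omega)]

/-- The `n × n` truncation of the Jacobi operator minus `2`: the tridiagonal Toeplitz matrix with
`-1` on the diagonal and `1` next to it. -/
def shiftedJacobi (n : ℕ) : Matrix (Fin n) (Fin n) ℝ :=
  Matrix.of fun a b => if a = b then -1 else if (a : ℕ) + 1 = b ∨ (b : ℕ) + 1 = a then 1 else 0

/-- The truncated matrix applied to an initial segment of a sequence; the last row lacks the
neighbour `f n`. -/
theorem sum_shiftedJacobi_mul {n : ℕ} (f : ℕ → ℝ) (a : Fin n) :
    ∑ b : Fin n, shiftedJacobi n a b * f b =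
      jacobiOp f a - 2 * f a - if (a : ℕ) + 1 = n then f n else 0 := by
  obtain ⟨a, ha⟩ := a
  simp only [shiftedJacobi, Matrix.of_apply, Fin.ext_iff]
  rw [Fin.sum_univ_eq_sum_range
    (fun b => (if a = b then (-1 : ℝ) else if a + 1 = b ∨ b + 1 = a then 1 else 0) * f b) n]
  have h (b : ℕ) : (if a = b then (-1 : ℝ) else if a + 1 = b ∨ b + 1 = a then 1 else 0) * f b =
      -(if a = b then f b else 0) + (if a + 1 = b then f b else 0) +
        (if b + 1 = a then f b else 0) := by
    split_ifs <;> first | omega | simp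
  simp only [h, Finset.sum_add_distrib, Finset.sum_neg_distrib, Finset.sum_ite_eq, Finset.mem_range]
  rw [if_pos ha]
  cases a with
  | zero =>
    simp only [jacobiOp, Nat.succ_ne_zero, if_false, Finset.sum_const_zero]
    split_ifs with h1 h2 h2 <;> first | omega | (try rw [← h2]) ; ring
  | succ a =>
    simp only [jacobiOp, Nat.add_right_cancel_iff, Finset.sum_ite_eq', Finset.mem_range,
      if_pos (show a < n by omega)]
    split_ifs with h1 h2 h2 <;> first | omega | (try rw [← h2]) ; ring

theorem det_shiftedJacobi_succ_succ (n : ℕ) :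
    (shiftedJacobi (n + 2)).det = -(shiftedJacobi (n + 1)).det - (shiftedJacobi n).det := by
  have h0 : (shiftedJacobi (n + 2)).submatrix Fin.succ (Fin.succAbove 0) =
      shiftedJacobi (n + 1) := by
    ext a b
    simp [shiftedJacobi]
  have h1 : ((shiftedJacobi (n + 2)).submatrix Fin.succ (Fin.succAbove 1)).det =
      (shiftedJacobi n).det := by
    rw [Matrix.det_succ_column_zero, Fin.sum_univ_succ, Finset.sum_eq_zero]
    · have h2 : ((shiftedJacobi (n + 2)).submatrix Fin.succ (Fin.succAbove 1)).submatrix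
          (Fin.succAbove 0) Fin.succ = shiftedJacobi n := by
        ext a b
        have hb : (Fin.succAbove 1 b.succ : Fin (n + 2)) = b.succ.succ := by
          rw [← Fin.succ_zero_eq_one, Fin.succ_succAbove_succ, Fin.succAbove_zero]
        simp [shiftedJacobi, hb]
      rw [h2]
      simp [shiftedJacobi]
    · intro a _
      simp [shiftedJacobi, Fin.ext_iff]
  rw [Matrix.det_succ_row_zero, Fin.sum_univ_succ, Fin.sum_univ_succ, Finset.sum_eq_zero]
  · rw [h0, Fin.succ_zero_eq_one, h1]
    simp [shiftedJacobi]
    ring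
  · intro a _
    simp [shiftedJacobi, Fin.ext_iff]

theorem det_shiftedJacobi : ∀ n, (shiftedJacobi n).det = orthoAtZero n
  | 0 => by simp [orthoAtZero]
  | 1 => by simp [orthoAtZero, shiftedJacobi]
  | n + 2 => by
    rw [det_shiftedJacobi_succ_succ, det_shiftedJacobi (n + 1), det_shiftedJacobi n, orthoAtZero]

/-- The Hankel matrix is congruent, by the unitriangular Motzkin triangle, to a rank-one
perturbation of a tridiagonal matrix. -/
theorem hankel_eq_motzkinTriangle_mul (n : ℕ) :
    (Matrix.of fun i j : Fin n =>
        intCoeff (motzkinSeries ^ 3) ((i : ℤ) + (j : ℤ) + (-3))) =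
      (Matrix.of fun i a : Fin n => motzkinTriangle i a) *
        (shiftedJacobi n + Matrix.vecMulVec (fun a : Fin n => orthoAtZero a)
          (fun a : Fin n => orthoAtZero a)) *
        (Matrix.of fun i a : Fin n => motzkinTriangle i a).transpose := by
  rw [Matrix.mul_add, Matrix.add_mul, Matrix.mul_vecMulVec, Matrix.vecMulVec_mul]
  ext i j
  have hv (i : Fin n) : ∑ a : Fin n, motzkinTriangle i a * orthoAtZero a =
      if (i : ℕ) = 0 then 1 else 0 := by
    rw [Fin.sum_univ_eq_sum_range (fun a => motzkinTriangle i a * orthoAtZero a),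
      sum_motzkinTriangle_mul_orthoAtZero i.isLt]
  have hs (i : Fin n) (k : ℕ) : ∑ a : Fin n, motzkinTriangle i a * motzkinTriangle k a =
      motzkinNumber (i + k) := by
    rw [Fin.sum_univ_eq_sum_range (fun a => motzkinTriangle i a * motzkinTriangle k a),
      sum_motzkinTriangle_mul i.isLt]
  rw [Matrix.mul_assoc, Matrix.add_apply, Matrix.vecMulVec_apply]
  simp only [Matrix.mul_apply, Matrix.of_apply, Matrix.transpose_apply, Matrix.mulVec, dotProduct,
    Matrix.vecMul, sum_shiftedJacobi_mul, motzkinTriangle_of_lt j.isLt, ite_self, sub_zero,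
    ← motzkinTriangle_succ]
  simp only [mul_comm (orthoAtZero _) (motzkinTriangle _ _), hv, mul_sub, Finset.sum_sub_distrib,
    mul_left_comm _ (2 : ℝ), ← Finset.mul_sum, hs]
  rw [show ((i : ℤ) + (j : ℤ) + (-3)) = (((i : ℕ) + (j : ℕ) : ℕ) : ℤ) - 3 by push_cast; ring,
    intCoeff_motzkinSeries_cube, add_assoc (i : ℕ)]
  congr 1
  by_cases hi : (i : ℕ) = 0 <;> by_cases hj : (j : ℕ) = 0 <;> simp [hi, hj]

/-! ### The determinant -/

theorem det_motzkinTriangle (n : ℕ) :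
    (Matrix.of fun i a : Fin n => motzkinTriangle i a).det = 1 := by
  rw [Matrix.det_of_isLowerTriangular _ fun i j hij => ?_]
  · simp [motzkinTriangle_self]
  · exact motzkinTriangle_of_lt (by simpa using hij)

/-- The solution `y` of `shiftedJacobi n * y = v`, where `v` is `orthoAtZero` cut off at `n`: it is
`-v` at the indices of parity opposite to `n`, and `0` at the others. -/
def parityOrtho (n a : ℕ) : ℝ := if Even (n + a) then 0 else -orthoAtZero a

theorem shiftedJacobi_mulVec (n : ℕ) :
    (shiftedJacobi n).mulVec (fun a : Fin n => parityOrtho n a) =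
      fun a : Fin n => orthoAtZero a := by
  funext a
  have hJ := congrFun jacobiOp_orthoAtZero a
  simp only [Matrix.mulVec, dotProduct, sum_shiftedJacobi_mul]
  -- The boundary term of the last row vanishes because `n + n` is even.
  have hn : parityOrtho n n = 0 := if_pos ⟨n, rfl⟩
  rw [hn, ite_self, sub_zero]
  obtain ⟨a, ha⟩ := a
  cases a with
  | zero =>
    simp only [jacobiOp, Pi.zero_apply] at hJ
    simp only [jacobiOp, parityOrtho, Nat.even_add_one, add_zero]
    split_ifs <;> linarith
  | succ a =>
    simp only [jacobiOp, Pi.zero_apply] at hJ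
    simp only [jacobiOp, parityOrtho, ← add_assoc, Nat.even_add_one,
      show n + (a + 2) = n + a + 1 + 1 by ring]
    split_ifs <;> linarith

/-- With `B = shiftedJacobi n` and `B y = v`, the matrix `B + v vᵀ` is `B (1 + y vᵀ)`, so its
determinant is `det B * (1 + v ⬝ y)`. No inverse of `B` is needed, so singular `B` are covered. -/
theorem shiftedHankelDet_eq (n : ℕ) : shiftedHankelDet motzkinSeries 3 (-3) n =
    orthoAtZero n * (1 + ∑ a ∈ Finset.range n, parityOrtho n a * orthoAtZero a) := by
  have h : shiftedJacobi n +
      Matrix.vecMulVec (fun a : Fin n => orthoAtZero a) (fun a : Fin n => orthoAtZero a) =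
      shiftedJacobi n * (1 + Matrix.vecMulVec (fun a : Fin n => parityOrtho n a)
        (fun a : Fin n => orthoAtZero a)) := by
    rw [Matrix.mul_add, Matrix.mul_one, Matrix.mul_vecMulVec, shiftedJacobi_mulVec]
  rw [shiftedHankelDet, hankel_eq_motzkinTriangle_mul, Matrix.det_mul, Matrix.det_mul,
    Matrix.det_transpose,
    det_motzkinTriangle, one_mul, mul_one, h, Matrix.det_mul, det_shiftedJacobi,
    Matrix.vecMulVec_eq Unit, Matrix.det_one_add_replicateCol_mul_replicateRow,
    ← Fin.sum_univ_eq_sum_range (fun a => parityOrtho n a * orthoAtZero a)]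
  simp [dotProduct, mul_comm]

theorem orthoAtZero_three_mul (k : ℕ) :
    orthoAtZero (3 * k) = 1 ∧ orthoAtZero (3 * k + 1) = -1 ∧ orthoAtZero (3 * k + 2) = 0 := by
  induction k with
  | zero => simp [orthoAtZero]
  | succ k ih =>
    obtain ⟨h0, h1, h2⟩ := ih
    have h3 : orthoAtZero (3 * k + 3) = 1 := by rw [orthoAtZero, h2, h1]; norm_num
    have h4 : orthoAtZero (3 * k + 4) = -1 := by rw [orthoAtZero, h3, h2]; norm_num
    have h5 : orthoAtZero (3 * k + 5) = 0 := by rw [orthoAtZero, h4, h3]; norm_num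
    exact ⟨h3, h4, h5⟩

theorem sum_parityOrtho_add_two (n : ℕ) :
    ∑ a ∈ Finset.range (n + 2), parityOrtho (n + 2) a * orthoAtZero a =
      ∑ a ∈ Finset.range n, parityOrtho n a * orthoAtZero a - orthoAtZero (n + 1) ^ 2 := by
  have h (a : ℕ) : parityOrtho (n + 2) a = parityOrtho n a := by
    simp only [parityOrtho, show n + 2 + a = n + a + 2 by ring, Nat.even_add, even_two, iff_true]
  have hn : parityOrtho n n = 0 := if_pos ⟨n, rfl⟩
  have hn' : parityOrtho n (n + 1) = -orthoAtZero (n + 1) := by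
    rw [parityOrtho, if_neg]
    rw [← add_assoc, Nat.even_add_one, not_not]
    exact ⟨n, rfl⟩
  simp only [h]
  rw [Finset.sum_range_succ, Finset.sum_range_succ, hn, hn']
  ring

theorem sum_parityOrtho_three_mul (k : ℕ) :
    ∑ a ∈ Finset.range (3 * k), parityOrtho (3 * k) a * orthoAtZero a = -k ∧
    ∑ a ∈ Finset.range (3 * k + 1), parityOrtho (3 * k + 1) a * orthoAtZero a = -(k + 1) := by
  induction k with
  | zero => simp [parityOrtho, orthoAtZero]
  | succ k ih =>
    obtain ⟨h0, h1⟩ := ih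
    obtain ⟨-, e1, e2⟩ := orthoAtZero_three_mul k
    obtain ⟨e3, -, -⟩ := orthoAtZero_three_mul (k + 1)
    have h2 := sum_parityOrtho_add_two (3 * k)
    have h3 := sum_parityOrtho_add_two (3 * k + 1)
    have h4 := sum_parityOrtho_add_two (3 * k + 2)
    rw [h0, e1] at h2
    rw [h1, e2] at h3
    rw [h2, show 3 * k + 2 + 1 = 3 * (k + 1) by ring, e3] at h4
    refine ⟨h3.trans ?_, h4.trans ?_⟩ <;> push_cast <;> ring

end

theorem proposition4p2 :
    (shiftedHankelDet motzkinSeries 3 (-3) 0 = 1 ∧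
      shiftedHankelDet motzkinSeries 3 (-3) 1 = 0 ∧
      shiftedHankelDet motzkinSeries 3 (-3) 2 = 0 ∧
      shiftedHankelDet motzkinSeries 3 (-3) 3 = 0) ∧
    ∀ n : ℕ, 4 ≤ n → ∀ k : ℕ,
      (n = 3 * k + 1 → shiftedHankelDet motzkinSeries 3 (-3) n = (k : ℝ)) ∧
      (n = 3 * k + 2 → shiftedHankelDet motzkinSeries 3 (-3) n = 0) ∧
      (n = 3 * k + 3 → shiftedHankelDet motzkinSeries 3 (-3) n = -(k : ℝ)) := by
  have h1 (k : ℕ) : shiftedHankelDet motzkinSeries 3 (-3) (3 * k + 1) = k := by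
    rw [shiftedHankelDet_eq, (sum_parityOrtho_three_mul k).2, (orthoAtZero_three_mul k).2.1]; ring
  have h2 (k : ℕ) : shiftedHankelDet motzkinSeries 3 (-3) (3 * k + 2) = 0 := by
    rw [shiftedHankelDet_eq, (orthoAtZero_three_mul k).2.2, zero_mul]
  have h3 (k : ℕ) : shiftedHankelDet motzkinSeries 3 (-3) (3 * k + 3) = -k := by
    rw [show 3 * k + 3 = 3 * (k + 1) by ring, shiftedHankelDet_eq,
      (sum_parityOrtho_three_mul (k + 1)).1,
      (orthoAtZero_three_mul (k + 1)).1]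
    push_cast; ring
  refine ⟨⟨?_, ?_, h2 0, ?_⟩, fun n _ k => ⟨?_, ?_, ?_⟩⟩
  · exact Matrix.det_isEmpty
  · simpa using h1 0
  · simpa using h3 0
  · rintro rfl; exact h1 k
  · rintro rfl; exact h2 k
  · rintro rfl; exact h3 k
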